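/- Let $(\mathcal C,\mathbb E,\mathfrak s)$ be an extriangulated category in the sense of Nakaoka and Palu, with $\mathcal C$ small: $\mathcal C$ is an additive category, $\mathbb E\colon \mathcal C^{\mathrm{op}}\times\mathcal C\to \mathrm{Ab}$ is a biadditive functor, $\mathfrak s$ is an additive realisation of $\mathbb E$, and the axioms (ET3), (ET3)$^{\mathrm{op}}$, (ET4), (ET4)$^{\mathrm{op}}$ hold. For $\delta\in\mathbb E(Z,X)$ write $p^*\delta=\mathbb E(p,X)(\delta)$ and $q_*\delta=\mathbb E(Z,q)(\delta)$. Let the weak idempotent completion $\hat{\mathcal C}$ be the following category. Its objects are the pairs $(A,p)$ with $A$ an object of $\mathcal C$ and $p\colon A\to A$ a split idempotent, i.e. $p=cr$ for some $r\colon A\to X$ and $c\colon X\to A$ with $rc=1_X$. A morphism $(A,p)\to(B,q)$ is a morphism $\sigma\colon A\to B$ of $\mathcal C$ with $\sigma p=q\sigma=\sigma$, and the identity of $(A,p)$ is $p$. (So $\hat{\mathcal C}$ is a full subcategory of the idempotent completion of $\mathcal C$; it is additive.) Let $j\colon\mathcal C\to\hat{\mathcal C}$ be the canonical embedding, $j(A)=(A,1_A)$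 and $j(f)=f$. Define $\mathbb F\colon\hat{\mathcal C}^{\mathrm{op}}\times\hat{\mathcal C}\to\mathrm{Ab}$ by $$\mathbb F((Z,p),(X,q))=p^*q_*\mathbb E(Z,X)\subseteq\mathbb E(Z,X),\qquad \mathbb F(\alpha,\beta)(\varepsilon)=\alpha^*\beta_*\varepsilon .$$ Then $\hat{\mathcal C}$ is extriangulated. More precisely, there is a correspondence $\mathfrak r$, assigning to each $\delta\in\mathbb F((Z,p),(X,q))$ an equivalence class of sequences $(X,q)\to(Y,g)\to(Z,p)$ in $\hat{\mathcal C}$, such that: 1. $(\hat{\mathcal C},\mathbb F,\mathfrak r)$ is an extriangulated category. 2. Whenever $\delta\in\mathbb F((Z,p),(X,q))$ and $\mathfrak s(\delta)=[X\overset{x}{\to}Y\overset{y}{\to}Z]$, there is a split idempotent $g\colon Y\to Y$ with $gx=xq$ and $yg=py$, and for every such $g$ $$\mathfrak r(\delta)=[(X,q)\overset{xq}{\longrightarrow}(Y,g)\overset{py}{\longrightarrow}(Z,p)].$$ 3. The functor $j$ is an extriangulated functor from $(\mathcal C,\mathbb E,\mathfrak s)$ to $(\hat{\mathcal C},\mathbb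 F,\mathfrak r)$: it is additive, and there is a natural transformation $\Gamma\colon\mathbb E\Rightarrow\mathbb F(j^{\mathrm{op}}-,j-)$ such that $\mathfrak s(\delta)=[X\overset{x}{\to}Y\overset{y}{\to}Z]$ implies $\mathfrak r(\Gamma_{(Z,X)}(\delta))=[j(X)\overset{j(x)}{\to}j(Y)\overset{j(y)}{\to}j(Z)]$. -/

import Mathlib

open CategoryTheory CategoryTheory.Limits CategoryTheory.Idempotents Opposite

universe w v v' u u'

noncomputable section

namespace Extriangulated

/-! ### Sequences `A ⟶ B ⟶ C` up to equivalence -/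

section Sequences

variable {C : Type u} [Category.{v} C]

/-- A sequence of morphisms `A --x--> B --y--> Z` with fixed ends `A` and `Z`. -/
structure Sequence (A Z : C) where
  /-- the middle object -/
  B : C
  /-- the first morphism -/
  x : A ⟶ B
  /-- the second morphism -/
  y : B ⟶ Z

/-- Two sequences with the same ends are equivalent if there is an isomorphism between the
middle objects that is compatible with the identities at the ends. -/
instance Sequence.setoid (A Z : C) : Setoid (Sequence A Z) where
  r S T := ∃ b : S.B ≅ T.B, S.x ≫ b.hom = T.x ∧ b.hom ≫ T.y = S.y
  iseqv :=
    { refl := fun S => ⟨Iso.refl _, by simp, by simp⟩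
      symm := by
        rintro S T ⟨b, h₁, h₂⟩
        exact ⟨b.symm, by simp [← h₁], by simp [← h₂]⟩
      trans := by
        rintro S T U ⟨b, h₁, h₂⟩ ⟨c, h₃, h₄⟩
        exact ⟨b ≪≫ c, by simp [← h₃, ← h₁], by simp [h₄, h₂]⟩ }

/-- Equivalence classes of sequences from `A` to `Z`. -/
def SequenceClass (A Z : C) : Type (max u v) := Quotient (Sequence.setoid A Z)

/-- The equivalence class `[A --x--> B --y--> Z]`. -/
def cls {A B Z : C} (x : A ⟶ B) (y : B ⟶ Z) : SequenceClass A Z :=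
  Quotient.mk (Sequence.setoid A Z) ⟨B, x, y⟩

variable [Preadditive C] [HasBinaryBiproducts C]

/-- The class `0` of the split sequence `A ⟶ A ⊕ Z ⟶ Z`. -/
def SequenceClass.split (A Z : C) : SequenceClass A Z :=
  cls (biprod.inl : A ⟶ A ⊞ Z) (biprod.snd : A ⊞ Z ⟶ Z)

/-- The direct sum of two equivalence classes of sequences. -/
def SequenceClass.directSum {A A' Z Z' : C} (S : SequenceClass A Z) (T : SequenceClass A' Z') :
    SequenceClass (A ⊞ A') (Z ⊞ Z') :=
  Quotient.map₂ (fun S T => (⟨S.B ⊞ T.B, biprod.map S.x T.x, biprod.map S.y T.y⟩ :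
      Sequence (A ⊞ A') (Z ⊞ Z')))
    (by
      rintro S S' ⟨b, h₁, h₂⟩ T T' ⟨c, h₃, h₄⟩
      refine ⟨biprod.mapIso b c, ?_, ?_⟩
      · ext <;> simp [← h₁, ← h₃]
      · ext <;> simp [← h₂, ← h₄])
    S T

end Sequences

/-! ### Extensions -/

section Extensions

variable {C : Type u} [Category.{v} C] (E : Cᵒᵖ ⥤ C ⥤ AddCommGrpCat.{w})

/-- The group `𝔼(Z, A)` of `𝔼`-extensions. -/
abbrev Ext (Z A : C) : Type w := (E.obj (op Z)).obj A

variable {E}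

/-- `a_* δ`. -/
def push {Z A A' : C} (a : A ⟶ A') (δ : Ext E Z A) : Ext E Z A' :=
  ((E.obj (op Z)).map a).hom δ

/-- `c^* δ`. -/
def pull {Z Z' A : C} (c : Z' ⟶ Z) (δ : Ext E Z A) : Ext E Z' A :=
  ((E.map c.op).app A).hom δ

/-- `δ ⊕ δ'`: the element of `𝔼(Z ⊕ Z', A ⊕ A')` whose components in `𝔼(Z, A)`, `𝔼(Z, A')`,
`𝔼(Z', A)` and `𝔼(Z', A')` are `δ`, `0`, `0` and `δ'`. -/
def extSum [Preadditive C] [HasBinaryBiproducts C] {Z Z' A A' : C}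
    (δ : Ext E Z A) (δ' : Ext E Z' A') : Ext E (Z ⊞ Z') (A ⊞ A') :=
  pull (biprod.fst : Z ⊞ Z' ⟶ Z) (push (biprod.inl : A ⟶ A ⊞ A') δ) +
    pull (biprod.snd : Z ⊞ Z' ⟶ Z') (push (biprod.inr : A' ⟶ A ⊞ A') δ')

variable (E)

/-- A correspondence that associates to each `δ ∈ 𝔼(Z, A)` an equivalence class of sequences
`A ⟶ B ⟶ Z`. -/
def Correspondence : Type (max u v w) :=
  ∀ ⦃A Z : C⦄, Ext E Z A → SequenceClass A Z

end Extensions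

/-! ### Extriangulated categories -/

section Axioms

variable {C : Type u} [Category.{v} C] {E : Cᵒᵖ ⥤ C ⥤ AddCommGrpCat.{w}}

/-- `𝔰` is a realisation of `𝔼`: each morphism of extensions `(a, c) : δ ⟶ δ'`, that is each pair
with `a_* δ = c^* δ'`, is realised by some triple `(a, b, c)`. -/
def IsRealisation (s : Correspondence E) : Prop :=
  ∀ ⦃A B Z A' B' Z' : C⦄ (δ : Ext E Z A) (δ' : Ext E Z' A')
    (x : A ⟶ B) (y : B ⟶ Z) (x' : A' ⟶ B') (y' : B' ⟶ Z'),
    s δ = cls x y → s δ' = cls x' y' →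
    ∀ (a : A ⟶ A') (c : Z ⟶ Z'), push a δ = pull c δ' →
      ∃ b : B ⟶ B', x ≫ b = a ≫ x' ∧ y ≫ c = b ≫ y'

/-- Axiom (ET3). -/
def ET3 (s : Correspondence E) : Prop :=
  ∀ ⦃A B Z A' B' Z' : C⦄ (δ : Ext E Z A) (δ' : Ext E Z' A')
    (x : A ⟶ B) (y : B ⟶ Z) (x' : A' ⟶ B') (y' : B' ⟶ Z'),
    s δ = cls x y → s δ' = cls x' y' →
    ∀ (a : A ⟶ A') (b : B ⟶ B'), x ≫ b = a ≫ x' →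
      ∃ c : Z ⟶ Z', push a δ = pull c δ' ∧ y ≫ c = b ≫ y'

/-- The dual of axiom (ET3). -/
def ET3op (s : Correspondence E) : Prop :=
  ∀ ⦃A B Z A' B' Z' : C⦄ (δ : Ext E Z A) (δ' : Ext E Z' A')
    (x : A ⟶ B) (y : B ⟶ Z) (x' : A' ⟶ B') (y' : B' ⟶ Z'),
    s δ = cls x y → s δ' = cls x' y' →
    ∀ (b : B ⟶ B') (c : Z ⟶ Z'), y ≫ c = b ≫ y' →
      ∃ a : A ⟶ A', push a δ = pull c δ' ∧ x ≫ b = a ≫ x'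

/-- Axiom (ET4). With `Z` for the middle term of the second sequence, the diagram is
```
A --f--> B --f'--> D
|        |g        |d
A --h--> Z --h'--> X
         |g'       |e
         F ======= F
``` -/
def ET4 (s : Correspondence E) : Prop :=
  ∀ ⦃A B D Z F : C⦄ (δ : Ext E D A) (δ' : Ext E F B)
    (f : A ⟶ B) (f' : B ⟶ D) (g : B ⟶ Z) (g' : Z ⟶ F),
    s δ = cls f f' → s δ' = cls g g' →
    ∃ (X : C) (d : D ⟶ X) (e : X ⟶ F) (h : A ⟶ Z) (h' : Z ⟶ X) (δ'' : Ext E X A),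
      f ≫ g = h ∧ f' ≫ d = g ≫ h' ∧ h' ≫ e = g' ∧
      s δ'' = cls h h' ∧
      s (push f' δ') = cls d e ∧
      pull d δ'' = δ ∧
      push f δ'' = pull e δ'

/-- The dual of axiom (ET4). The diagram is
```
D --d--> X --e--> F
|        |h'      |g'
D --f'-> A --f--> B
         |h       |g
         Z ====== Z
``` -/
def ET4op (s : Correspondence E) : Prop :=
  ∀ ⦃A B D Z F : C⦄ (δ : Ext E B D) (δ' : Ext E Z F)
    (f' : D ⟶ A) (f : A ⟶ B) (g' : F ⟶ B) (g : B ⟶ Z),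
    s δ = cls f' f → s δ' = cls g' g →
    ∃ (X : C) (d : D ⟶ X) (e : X ⟶ F) (h' : X ⟶ A) (h : A ⟶ Z) (δ'' : Ext E Z X),
      f ≫ g = h ∧ e ≫ g' = h' ≫ f ∧ d ≫ h' = f' ∧
      s δ'' = cls h' h ∧
      s (pull g' δ) = cls d e ∧
      push e δ'' = δ' ∧
      push d δ = pull g δ''

variable [Preadditive C] [HasZeroObject C] [HasBinaryBiproducts C]

/-- `(C, 𝔼, 𝔰)` is an extriangulated category (the additivity of the category `C` is expressed by
the type class arguments). -/
structure IsExtriangulated (E : Cᵒᵖ ⥤ C ⥤ AddCommGrpCat.{w}) (s : Correspondence E) : Prop where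
  /-- (ET1): `𝔼` is additive in its covariant argument -/
  additive_right : ∀ Z : Cᵒᵖ, (E.obj Z).Additive
  /-- (ET1): `𝔼` is additive in its contravariant argument -/
  additive_left : ∀ A : C, (E.flip.obj A).Additive
  /-- (ET2): `𝔰` is a realisation -/
  realisation : IsRealisation s
  /-- (ET2): `𝔰(0) = 0` -/
  realise_zero : ∀ A Z : C, s (0 : Ext E Z A) = SequenceClass.split A Z
  /-- (ET2): `𝔰(δ ⊕ δ') = 𝔰(δ) ⊕ 𝔰(δ')` -/
  realise_sum : ∀ ⦃A Z A' Z' : C⦄ (δ : Ext E Z A) (δ' : Ext E Z' A'),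
    s (extSum δ δ') = SequenceClass.directSum (s δ) (s δ')
  et3 : ET3 s
  et3op : ET3op s
  et4 : ET4 s
  et4op : ET4op s

end Axioms

/-! ### Extriangulated functors -/

section Functors

variable {C : Type u} [Category.{v} C] {D : Type u'} [Category.{v'} D]

/-- The bifunctor `𝔼'(Fᵒᵖ -, F -)`. -/
def restrictBifunctor (F : C ⥤ D) (E' : Dᵒᵖ ⥤ D ⥤ AddCommGrpCat.{w}) :
    Cᵒᵖ ⥤ C ⥤ AddCommGrpCat.{w} :=
  F.op ⋙ E' ⋙ (Functor.whiskeringLeft C D AddCommGrpCat.{w}).obj F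

/-- The component `Γ_{(Z, A)} : 𝔼(Z, A) → 𝔼'(F Z, F A)` of a natural transformation
`Γ : 𝔼 ⟶ 𝔼'(Fᵒᵖ -, F -)`. -/
def component {F : C ⥤ D} {E : Cᵒᵖ ⥤ C ⥤ AddCommGrpCat.{w}} {E' : Dᵒᵖ ⥤ D ⥤ AddCommGrpCat.{w}}
    (Γ : E ⟶ restrictBifunctor F E') {Z A : C} (δ : Ext E Z A) : Ext E' (F.obj Z) (F.obj A) :=
  ((Γ.app (op Z)).app A).hom δ

/-- `F` is an extriangulated functor from `(C, 𝔼, 𝔰)` to `(D, 𝔼', 𝔰')`. -/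
def IsExtriangulatedFunctor [Preadditive C] [Preadditive D]
    {E : Cᵒᵖ ⥤ C ⥤ AddCommGrpCat.{w}} (s : Correspondence E)
    {E' : Dᵒᵖ ⥤ D ⥤ AddCommGrpCat.{w}} (s' : Correspondence E') (F : C ⥤ D) : Prop :=
  F.Additive ∧ ∃ Γ : E ⟶ restrictBifunctor F E',
    ∀ ⦃A B Z : C⦄ (δ : Ext E Z A) (x : A ⟶ B) (y : B ⟶ Z),
      s δ = cls x y → s' (component Γ δ) = cls (F.map x) (F.map y)

end Functors

/-! ### The weak idempotent completion -/

section Completion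

variable (C : Type u) [Category.{v} C]

variable {C} in
/-- The endomorphism `p` is a split idempotent: `p = c ∘ r` with `r ∘ c = 1`. -/
def IsSplitIdempotent {A : C} (p : A ⟶ A) : Prop :=
  ∃ (X : C) (r : A ⟶ X) (c : X ⟶ A), r ≫ c = p ∧ c ≫ r = 𝟙 X

variable {C} in
lemma IsSplitIdempotent.idem {A : C} {p : A ⟶ A} (hp : IsSplitIdempotent p) : p ≫ p = p := by
  obtain ⟨X, r, c, rfl, h⟩ := hp
  simp [reassoc_of% h]

/-- The pairs `(A, p)` in the idempotent completion `Karoubi C` for which `p` is a split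
idempotent. -/
def splitProperty : ObjectProperty (Karoubi C) := fun P => IsSplitIdempotent P.p

/-- The weak idempotent completion of `C`: the full subcategory of the idempotent completion on
the pairs `(A, p)` with `p` a split idempotent. -/
abbrev WeakCompletion : Type (max u v) := (splitProperty C).FullSubcategory

/-- The canonical embedding `A ↦ (A, 1_A)`, `f ↦ f`. -/
def embedding : C ⥤ WeakCompletion C :=
  (splitProperty C).lift (toKaroubi C) (fun A => ⟨A, 𝟙 A, 𝟙 A, by simp, by simp⟩)

variable {C} in
/-- The object `(A, p)` of the weak idempotent completion. -/
def WeakCompletion.mk {A : C} (p : A ⟶ A) (hp : IsSplitIdempotent p) : WeakCompletion C :=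
  ⟨⟨A, p, hp.idem⟩, hp⟩

/-- The weak idempotent completion has a zero object. -/
instance hasZeroObject_weakCompletion [Preadditive C] [HasZeroObject C] :
    HasZeroObject (WeakCompletion C) := by
  obtain ⟨Z, hZ⟩ := HasZeroObject.zero (C := C)
  refine ⟨⟨(embedding C).obj Z, ?_⟩⟩
  rw [IsZero.iff_id_eq_zero]
  exact ObjectProperty.hom_ext _ (Karoubi.hom_ext _ _ (hZ.eq_of_src _ _))

/-- The weak idempotent completion has binary biproducts, namely
`(A, p) ⊕ (B, q) = (A ⊕ B, p ⊕ q)`. -/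
instance hasBinaryBiproducts_weakCompletion [Preadditive C] [HasBinaryBiproducts C] :
    HasBinaryBiproducts (WeakCompletion C) where
  has_binary_biproduct P Q := by
    have hsplit : IsSplitIdempotent (biprod.map P.obj.p Q.obj.p) := by
      obtain ⟨X, r, c, h₁, h₂⟩ := P.property
      obtain ⟨X', r', c', h₁', h₂'⟩ := Q.property
      exact ⟨X ⊞ X', biprod.map r r', biprod.map c c', by ext <;> simp [← h₁, ← h₁'],
        by ext <;> simp [h₂, h₂']⟩
    let b : BinaryBicone P Q :=
      { pt := WeakCompletion.mk (biprod.map P.obj.p Q.obj.p) hsplit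
        fst := ObjectProperty.homMk ⟨biprod.fst ≫ P.obj.p, by simp [WeakCompletion.mk]⟩
        snd := ObjectProperty.homMk ⟨biprod.snd ≫ Q.obj.p, by simp [WeakCompletion.mk]⟩
        inl := ObjectProperty.homMk ⟨P.obj.p ≫ biprod.inl, by simp [WeakCompletion.mk]⟩
        inr := ObjectProperty.homMk ⟨Q.obj.p ≫ biprod.inr, by simp [WeakCompletion.mk]⟩
        inl_fst := by
          ext
          change (P.obj.p ≫ (biprod.inl : _ ⟶ P.obj.X ⊞ Q.obj.X)) ≫ biprod.fst ≫ P.obj.p = P.obj.p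
          simp
        inl_snd := by
          ext
          change (P.obj.p ≫ (biprod.inl : _ ⟶ P.obj.X ⊞ Q.obj.X)) ≫ biprod.snd ≫ Q.obj.p = 0
          simp
        inr_fst := by
          ext
          change (Q.obj.p ≫ (biprod.inr : _ ⟶ P.obj.X ⊞ Q.obj.X)) ≫ biprod.fst ≫ P.obj.p = 0
          simp
        inr_snd := by
          ext
          change (Q.obj.p ≫ (biprod.inr : _ ⟶ P.obj.X ⊞ Q.obj.X)) ≫ biprod.snd ≫ Q.obj.p = Q.obj.p
          simp }
    have total : ((biprod.fst : P.obj.X ⊞ Q.obj.X ⟶ _) ≫ P.obj.p) ≫ P.obj.p ≫ biprod.inl +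
        ((biprod.snd : P.obj.X ⊞ Q.obj.X ⟶ _) ≫ Q.obj.p) ≫ Q.obj.p ≫ biprod.inr =
          biprod.map P.obj.p Q.obj.p := by
      ext <;> simp
    refine hasBinaryBiproduct_of_total b ?_
    ext
    exact total

end Completion

/-! ### The bifunctor on the completion -/

section Bifunctor

variable {C : Type u} [Category.{v} C] (E : Cᵒᵖ ⥤ C ⥤ AddCommGrpCat.{w})

/-- The homomorphism `δ ↦ α^* β_* δ` from `𝔼(Z, A)` to `𝔼(Z', A')`. -/
def pullPush {Z Z' A A' : C} (α : Z' ⟶ Z) (β : A ⟶ A') : Ext E Z A →+ Ext E Z' A' :=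
  ((E.map α.op).app A').hom.comp ((E.obj (op Z)).map β).hom

lemma pullPush_comp {Z Z' Z'' A A' A'' : C} (α : Z' ⟶ Z) (α' : Z'' ⟶ Z') (β : A ⟶ A')
    (β' : A' ⟶ A'') (δ : Ext E Z A) :
    pullPush E α' β' (pullPush E α β δ) = pullPush E (α' ≫ α) (β ≫ β') δ := by
  have h := ConcreteCategory.congr_hom ((E.map α.op).naturality β') (((E.obj (op Z)).map β).hom δ)
  simp only [pullPush, op_comp, Functor.map_comp, NatTrans.comp_app]
  exact congrArg ((E.map α'.op).app A'').hom h.symm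

/-- The subgroup `p^* q_* 𝔼(Z, X)` of `𝔼(Z, X)`. -/
def cutSubgroup (P Q : Karoubi C) : AddSubgroup (Ext E P.X Q.X) := (pullPush E P.p Q.p).range

lemma pullPush_idem (P Q : Karoubi C) (ε : cutSubgroup E P Q) :
    pullPush E P.p Q.p ε = (ε : Ext E P.X Q.X) := by
  obtain ⟨_, δ, rfl⟩ := ε
  simp [pullPush_comp]

/-- The homomorphism `ε ↦ α^* β_* ε` between the subgroups of extensions. -/
def cutMap {P P' Q Q' : Karoubi C} (α : P' ⟶ P) (β : Q ⟶ Q') :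
    cutSubgroup E P Q →+ cutSubgroup E P' Q' :=
  ((pullPush E α.f β.f).comp (cutSubgroup E P Q).subtype).codRestrict (cutSubgroup E P' Q') (by
    rintro ⟨_, δ, rfl⟩
    exact ⟨pullPush E α.f β.f δ, by simp [pullPush_comp]⟩)

lemma cutMap_id (P Q : Karoubi C) (ε : cutSubgroup E P Q) : cutMap E (𝟙 P) (𝟙 Q) ε = ε :=
  Subtype.ext (pullPush_idem E P Q ε)

lemma cutMap_comp {P P' P'' Q Q' Q'' : Karoubi C} (α : P' ⟶ P) (α' : P'' ⟶ P') (β : Q ⟶ Q')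
    (β' : Q' ⟶ Q'') (ε : cutSubgroup E P Q) :
    cutMap E α' β' (cutMap E α β ε) = cutMap E (α' ≫ α) (β ≫ β') ε :=
  Subtype.ext (pullPush_comp E α.f α'.f β.f β'.f ε)

/-- The bifunctor `𝔽` on the idempotent completion, with `𝔽((Z, p), (X, q)) = p^* q_* 𝔼(Z, X)` and
`𝔽(α, β)(ε) = α^* β_* ε`. -/
def karoubiBifunctor : (Karoubi C)ᵒᵖ ⥤ Karoubi C ⥤ AddCommGrpCat.{w} where
  obj P :=
    { obj := fun Q => AddCommGrpCat.of (cutSubgroup E P.unop Q)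
      map := fun β => AddCommGrpCat.ofHom (cutMap E (𝟙 P.unop) β)
      map_id := fun Q => AddCommGrpCat.hom_ext (AddMonoidHom.ext (cutMap_id E P.unop Q))
      map_comp := fun β β' => AddCommGrpCat.hom_ext (AddMonoidHom.ext fun ε => by
        have h := cutMap_comp E (𝟙 P.unop) (𝟙 P.unop) β β' ε
        rw [Category.comp_id] at h
        exact h.symm) }
  map {P P'} α :=
    { app := fun Q => AddCommGrpCat.ofHom (cutMap E α.unop (𝟙 Q))
      naturality := fun Q Q' β => AddCommGrpCat.hom_ext (AddMonoidHom.ext fun ε => by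
        have h := cutMap_comp E (𝟙 P.unop) α.unop β (𝟙 Q') ε
        have h' := cutMap_comp E α.unop (𝟙 P'.unop) (𝟙 Q) β ε
        rw [Category.comp_id, Category.comp_id] at h
        rw [Category.id_comp, Category.id_comp] at h'
        exact h.trans h'.symm) }
  map_id P := by
    ext Q : 2
    exact AddCommGrpCat.hom_ext (AddMonoidHom.ext (cutMap_id E P.unop Q))
  map_comp α α' := by
    ext Q : 2
    refine AddCommGrpCat.hom_ext (AddMonoidHom.ext fun ε => ?_)
    have h := cutMap_comp E α.unop α'.unop (𝟙 Q) (𝟙 Q) ε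
    rw [Category.comp_id] at h
    exact h.symm

/-- The restriction of `𝔽` to the weak idempotent completion. -/
def weakBifunctor : (WeakCompletion C)ᵒᵖ ⥤ WeakCompletion C ⥤ AddCommGrpCat.{w} :=
  restrictBifunctor (splitProperty C).ι (karoubiBifunctor E)

variable {E}

/-- The element of `𝔼(Z, X)` underlying an element of `𝔽((Z, p), (X, q))`. -/
def underlying {Z X : WeakCompletion C} (δ : Ext (weakBifunctor E) Z X) :
    Ext E Z.obj.X X.obj.X :=
  Subtype.val (p := fun ε => ε ∈ cutSubgroup E Z.obj X.obj) δ

/-- The class `[(X, q) --xq--> (Y, g) --py--> (Z, p)]`, where `g` is a split idempotent of `Y` with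
`g x = x q` and `y g = p y`. -/
def cutClass {X Z : WeakCompletion C} {Y : C} (x : X.obj.X ⟶ Y) (y : Y ⟶ Z.obj.X) (g : Y ⟶ Y)
    (hg : IsSplitIdempotent g) (hx : x ≫ g = X.obj.p ≫ x) (hy : g ≫ y = y ≫ Z.obj.p) :
    SequenceClass X Z :=
  cls (B := WeakCompletion.mk g hg)
    (ObjectProperty.homMk ⟨X.obj.p ≫ x, by
      simp [WeakCompletion.mk, hx]⟩)
    (ObjectProperty.homMk ⟨y ≫ Z.obj.p, by
      simp [WeakCompletion.mk, reassoc_of% hy]⟩)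

/-- `𝔯` is the correspondence on the weak idempotent completion that is cut out of `𝔰`: for
`δ ∈ 𝔽((Z, p), (X, q))` with `𝔰(δ) = [X --x--> Y --y--> Z]`, there are split idempotents `g` of `Y`
with `g x = x q` and `y g = p y`, and for each of them
`𝔯(δ) = [(X, q) --xq--> (Y, g) --py--> (Z, p)]`. -/
def IsCutOut (s : Correspondence E) (r : Correspondence (weakBifunctor E)) : Prop :=
  ∀ ⦃X Z : WeakCompletion C⦄ (δ : Ext (weakBifunctor E) Z X) ⦃Y : C⦄
    (x : X.obj.X ⟶ Y) (y : Y ⟶ Z.obj.X), s (underlying δ) = cls x y →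
    (∃ g : Y ⟶ Y, IsSplitIdempotent g ∧ x ≫ g = X.obj.p ≫ x ∧ g ≫ y = y ≫ Z.obj.p) ∧
    ∀ (g : Y ⟶ Y) (hg : IsSplitIdempotent g) (hx : x ≫ g = X.obj.p ≫ x)
      (hy : g ≫ y = y ≫ Z.obj.p), r δ = cutClass x y g hg hx hy

end Bifunctor

end Extriangulated

end

noncomputable section

namespace Extriangulated

/-! ### Calculus of sequence classes and of push and pull -/

section Basic

variable {C : Type u} [Category.{v} C]

/-! Every idempotent admitted in the weak completion already splits in `C`, so the completion has no
new objects up to isomorphism: choosing a splitting `p = c r` of each object gives a fully faithful,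
essentially surjective additive functor `imageFunctor` to `C`. Moreover `ε ↦ c^* r_* ε` identifies
`p^* q_* 𝔼(Z, X)` with the extension group of the splitting objects (`extImageEquiv`), compatibly
with push and pull. Extriangulated structures transport along such data
(`IsExtriangulated.transport`), and this produces `𝔯`.

The content lies in the explicit formula for `𝔯`. For `δ` in the subgroup, the extension of
splitting objects corresponding to `δ` is a retract of `δ`. By `exists_retraction` the retraction
extends to the middle terms, and inclusion after retraction on the middle term is the required
idempotent `g`. Conversely, any admissible `g` cuts out a sequence that is a retract of `𝔰(δ)`, and
`realise_retract` shows that such a sequence realises the retracted extension. Both rest on one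
fact: an endomorphism of the middle term over the identities of the ends is `1 + n` with `n² = 0`,
hence invertible.

The statement on `j` is the case of the formula in which all idempotents are identities. -/

lemma cls_eq_cls_of_iso {A Z B B' : C} {x : A ⟶ B} {y : B ⟶ Z} {x' : A ⟶ B'} {y' : B' ⟶ Z}
    (b : B ≅ B') (hx : x ≫ b.hom = x') (hy : b.hom ≫ y' = y) : cls x y = cls x' y' :=
  Quotient.sound ⟨b, hx, hy⟩

lemma cls_eq_cls_iff {A Z B B' : C} {x : A ⟶ B} {y : B ⟶ Z} {x' : A ⟶ B'} {y' : B' ⟶ Z} :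
    cls x y = cls x' y' ↔ ∃ b : B ≅ B', x ≫ b.hom = x' ∧ b.hom ≫ y' = y :=
  ⟨fun h => Quotient.exact h, fun ⟨b, hx, hy⟩ => cls_eq_cls_of_iso b hx hy⟩

lemma SequenceClass.exists_rep {A Z : C} (S : SequenceClass A Z) :
    ∃ (B : C) (x : A ⟶ B) (y : B ⟶ Z), S = cls x y := by
  induction S using Quotient.inductionOn with
  | h S => exact ⟨S.B, S.x, S.y, rfl⟩

variable {E : Cᵒᵖ ⥤ C ⥤ AddCommGrpCat.{w}}

@[simp] lemma push_id {Z A : C} (δ : Ext E Z A) : push (𝟙 A) δ = δ := by simp [push]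

@[simp] lemma pull_id {Z A : C} (δ : Ext E Z A) : pull (𝟙 Z) δ = δ := by simp [pull]

lemma push_push {Z A A' A'' : C} (a : A ⟶ A') (a' : A' ⟶ A'') (δ : Ext E Z A) :
    push a' (push a δ) = push (a ≫ a') δ := by simp [push]

lemma pull_pull {Z Z' Z'' A : C} (c : Z' ⟶ Z) (c' : Z'' ⟶ Z') (δ : Ext E Z A) :
    pull c' (pull c δ) = pull (c' ≫ c) δ := by simp [pull]

lemma push_pull {Z Z' A A' : C} (c : Z' ⟶ Z) (a : A ⟶ A') (δ : Ext E Z A) :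
    push a (pull c δ) = pull c (push a δ) :=
  (ConcreteCategory.congr_hom ((E.map c.op).naturality a) δ).symm

lemma pullPush_apply {Z Z' A A' : C} (c : Z' ⟶ Z) (a : A ⟶ A') (δ : Ext E Z A) :
    pullPush E c a δ = pull c (push a δ) := rfl

lemma push_add {Z A A' : C} (a : A ⟶ A') (δ δ' : Ext E Z A) :
    push a (δ + δ') = push a δ + push a δ' :=
  map_add ((E.obj (op Z)).map a).hom δ δ'

lemma pull_add {Z Z' A : C} (c : Z' ⟶ Z) (δ δ' : Ext E Z A) :
    pull c (δ + δ') = pull c δ + pull c δ' :=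
  map_add ((E.map c.op).app A).hom δ δ'

end Basic

/-! ### Exactness of realised sequences, and their retracts -/

section Exactness

variable {C : Type u} [Category.{v} C] [Preadditive C] [HasBinaryBiproducts C]
  {E : Cᵒᵖ ⥤ C ⥤ AddCommGrpCat.{w}} {s : Correspondence E} (hC : IsExtriangulated E s)

lemma SequenceClass.directSum_cls {A B Z A' B' Z' : C} (x : A ⟶ B) (y : B ⟶ Z) (x' : A' ⟶ B')
    (y' : B' ⟶ Z') : SequenceClass.directSum (cls x y) (cls x' y') =
      cls (biprod.map x x') (biprod.map y y') := rfl

namespace IsExtriangulated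

include hC

lemma add_push {Z A A' : C} (a a' : A ⟶ A') (δ : Ext E Z A) :
    push (a + a') δ = push a δ + push a' δ := by
  have := hC.additive_right (op Z)
  simp [push, (E.obj (op Z)).map_add]

lemma add_pull {Z Z' A : C} (c c' : Z' ⟶ Z) (δ : Ext E Z A) :
    pull (c + c') δ = pull c δ + pull c' δ := by
  have := hC.additive_left A
  have h := (E.flip.obj A).map_add (f := c.op) (g := c'.op)
  exact congrArg (fun f => f.hom δ) h

lemma realise_zero_right {A Z : C} (hZ : IsZero Z) : s (0 : Ext E Z A) = cls (𝟙 A) 0 := by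
  rw [hC.realise_zero]
  exact cls_eq_cls_of_iso ⟨biprod.fst, biprod.inl, by ext <;> simp [hZ.eq_of_src _ 0], by simp⟩
    (by simp) (hZ.eq_of_tgt _ _)

variable [HasZeroObject C] {A B Z : C} {δ : Ext E Z A} {x : A ⟶ B} {y : B ⟶ Z} (h : s δ = cls x y)

include h

/-- Dual (ET3) is applied to a map from the trivial sequence `W = W ⟶ 0`, which realises the zero
extension: its component on first terms is the lift. -/
lemma exists_lift {W : C} (f : W ⟶ B) (hf : f ≫ y = 0) : ∃ g : W ⟶ A, g ≫ x = f := by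
  obtain ⟨a, -, ha⟩ := hC.et3op _ _ _ _ _ _ (hC.realise_zero_right (isZero_zero C) (A := W)) h
    f 0 (by simp [hf])
  exact ⟨a, by simpa using ha.symm⟩

/-- If a sequence is a retract of a realised sequence, then the endomorphisms of its middle term
over the identities of its ends are invertible. -/
lemma isIso_of_retract {A' B' Z' : C} {x' : A' ⟶ B'} {y' : B' ⟶ Z'}
    (cB : B' ⟶ B) (cZ : Z' ⟶ Z) (rA : A ⟶ A') (rB : B ⟶ B') (hB : cB ≫ rB = 𝟙 B')
    (hcy : cB ≫ y = y' ≫ cZ) (hrx : x ≫ rB = rA ≫ x')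
    (φ : B' ⟶ B') (hx : x' ≫ φ = x') (hy : φ ≫ y' = y') : IsIso φ := by
  -- The retract need not be realised, so exactness is used in the ambient sequence, where `(φ - 1)
  -- cB` is killed by `y`.
  obtain ⟨u, hu⟩ := hC.exists_lift h ((φ - 𝟙 B') ≫ cB) (by
    rw [Category.assoc, hcy, ← Category.assoc, Preadditive.sub_comp, hy]; simp)
  have h₁ : φ - 𝟙 B' = u ≫ rA ≫ x' := by
    rw [← hrx, ← Category.assoc, hu, Category.assoc, hB, Category.comp_id]
  -- The first factor `φ - 1` ends in `x'`, which the second one kills.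
  have h₂ : (φ - 𝟙 B') ≫ (φ - 𝟙 B') = 0 := by
    conv_lhs => lhs; rw [h₁]
    simp [Preadditive.comp_sub, hx]
  have h₃ : φ ≫ φ = φ + φ - 𝟙 B' := by
    simp only [Preadditive.sub_comp, Preadditive.comp_sub, Category.comp_id,
      Category.id_comp] at h₂
    rw [← sub_eq_zero, ← h₂]; abel
  -- With `φ = 1 + n` and `n² = 0`, the inverse is `1 - n = 2 - φ`.
  refine ⟨𝟙 B' + 𝟙 B' - φ, ?_, ?_⟩
  · simp [Preadditive.comp_sub, h₃]
  · simp [Preadditive.sub_comp, h₃]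

lemma isIso_of_endo (φ : B ⟶ B) (hx : x ≫ φ = x) (hy : φ ≫ y = y) : IsIso φ :=
  hC.isIso_of_retract h (𝟙 B) (𝟙 Z) (𝟙 A) (𝟙 B) (by simp) (by simp) (by simp) φ hx hy

/-- A sequence which is a retract of a realised sequence, compatibly with the extensions, is
realised by the retracted extension. -/
lemma realise_retract {A' B' Z' : C} {δ' : Ext E Z' A'} {x' : A' ⟶ B'} {y' : B' ⟶ Z'}
    (cA : A' ⟶ A) (cB : B' ⟶ B) (cZ : Z' ⟶ Z) (rA : A ⟶ A') (rB : B ⟶ B') (rZ : Z ⟶ Z')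
    (hA : cA ≫ rA = 𝟙 A') (hB : cB ≫ rB = 𝟙 B') (hZ : cZ ≫ rZ = 𝟙 Z')
    (hcx : x' ≫ cB = cA ≫ x) (hcy : cB ≫ y = y' ≫ cZ)
    (hrx : x ≫ rB = rA ≫ x') (hry : rB ≫ y' = y ≫ rZ)
    (hc : push cA δ' = pull cZ δ) (hr : push rA δ = pull rZ δ') : s δ' = cls x' y' := by
  -- An arbitrary realisation of `δ'` is compared with the given sequence by passing through `B`;
  -- both round trips lie over identities of the ends, hence are invertible.
  obtain ⟨B'', x'', y'', h'⟩ := (s δ').exists_rep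
  obtain ⟨b, hbx, hby⟩ := hC.realisation _ _ _ _ _ _ h' h cA cZ hc
  obtain ⟨b', hbx', hby'⟩ := hC.realisation _ _ _ _ _ _ h h' rA rZ hr
  have i₁ : IsIso ((cB ≫ b') ≫ b ≫ rB) := by
    refine hC.isIso_of_retract h cB cZ rA rB hB hcy hrx _ ?_ ?_
    · simp only [Category.assoc]
      rw [reassoc_of% hcx, reassoc_of% hbx', reassoc_of% hA, reassoc_of% hbx, hrx,
        reassoc_of% hA]
    · simp only [Category.assoc]
      rw [hry, ← reassoc_of% hby, hZ, Category.comp_id, ← hby', reassoc_of% hcy, hZ,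
        Category.comp_id]
  have i₂ : IsIso ((b ≫ rB) ≫ cB ≫ b') := by
    refine hC.isIso_of_endo h' _ ?_ ?_
    · simp only [Category.assoc]
      rw [reassoc_of% hbx, reassoc_of% hrx, reassoc_of% hA, reassoc_of% hcx, hbx',
        reassoc_of% hA]
    · simp only [Category.assoc]
      rw [← hby', reassoc_of% hcy, hZ, Category.comp_id, hry, ← reassoc_of% hby, hZ,
        Category.comp_id]
  have : IsIso (b ≫ rB) := by
    have : IsSplitEpi (b ≫ rB) := ⟨⟨⟨inv ((cB ≫ b') ≫ b ≫ rB) ≫ cB ≫ b', by simp⟩⟩⟩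
    have : Mono (b ≫ rB) := mono_of_mono (b ≫ rB) (cB ≫ b')
    exact isIso_of_mono_of_isSplitEpi _
  rw [h']
  refine cls_eq_cls_of_iso (asIso (b ≫ rB)) ?_ ?_
  · simp [reassoc_of% hbx, hrx, reassoc_of% hA]
  · simp [hry, ← reassoc_of% hby, hZ]

/-- An isomorphism is a retraction, with the inverses as inclusions. -/
lemma realise_iso {A' B' Z' : C} {δ' : Ext E Z' A'} {x' : A' ⟶ B'} {y' : B' ⟶ Z'}
    (a : A ≅ A') (b : B ≅ B') (c : Z ≅ Z') (hx : x ≫ b.hom = a.hom ≫ x')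
    (hy : b.hom ≫ y' = y ≫ c.hom) (hδ : push a.hom δ = pull c.hom δ') : s δ' = cls x' y' := by
  refine hC.realise_retract h a.inv b.inv c.inv a.hom b.hom c.hom (by simp) (by simp) (by simp)
    ?_ ?_ hx hy ?_ hδ
  · rw [Iso.comp_inv_eq, Category.assoc, hx, Iso.inv_hom_id_assoc]
  · rw [Iso.inv_comp_eq, ← Category.assoc, Iso.eq_comp_inv, hy]
  · have : δ' = pull c.inv (push a.hom δ) := by rw [hδ, pull_pull]; simp
    rw [this, push_pull, push_push]; simp

/-- Maps between the ends that form a retraction of extensions extend to a retraction of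
realisations. -/
lemma exists_retraction {A' B' Z' : C} {δ' : Ext E Z' A'} {x' : A' ⟶ B'} {y' : B' ⟶ Z'}
    (h' : s δ' = cls x' y')
    (cA : A' ⟶ A) (cZ : Z' ⟶ Z) (rA : A ⟶ A') (rZ : Z ⟶ Z')
    (hA : cA ≫ rA = 𝟙 A') (hZ : cZ ≫ rZ = 𝟙 Z')
    (hc : push cA δ' = pull cZ δ) (hr : push rA δ = pull rZ δ') :
    ∃ (cB : B' ⟶ B) (rB : B ⟶ B'), cB ≫ rB = 𝟙 B' ∧ x' ≫ cB = cA ≫ x ∧ cB ≫ y = y' ≫ cZ ∧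
      x ≫ rB = rA ≫ x' ∧ rB ≫ y' = y ≫ rZ := by
  obtain ⟨b, hbx, hby⟩ := hC.realisation _ _ _ _ _ _ h' h cA cZ hc
  obtain ⟨b', hbx', hby'⟩ := hC.realisation _ _ _ _ _ _ h h' rA rZ hr
  have hx : x' ≫ b ≫ b' = x' := by rw [reassoc_of% hbx, hbx', reassoc_of% hA]
  have hy : (b ≫ b') ≫ y' = y' := by
    rw [Category.assoc, ← hby', ← reassoc_of% hby, hZ, Category.comp_id]
  have := hC.isIso_of_endo h' _ hx hy
  -- The realised maps compose only to an automorphism of `B'`. Correcting the second by its inverse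
  -- gives a true retraction, and the squares survive because this automorphism fixes `x'` and `y'`.
  refine ⟨b, b' ≫ inv (b ≫ b'), ?_, hbx, hby.symm, ?_, ?_⟩
  · rw [← Category.assoc, IsIso.hom_inv_id]
  · rw [reassoc_of% hbx', ← (IsIso.eq_comp_inv _).2 hx]
  · rw [Category.assoc, (IsIso.inv_comp_eq _).2 hy.symm, hby']

end IsExtriangulated

end Exactness

/-! ### Transport along an equivalence -/

section Transport

variable {C : Type u} [Category.{v} C] {D : Type u'} [Category.{v'} D]
  {E : Cᵒᵖ ⥤ C ⥤ AddCommGrpCat.{w}} {E' : Dᵒᵖ ⥤ D ⥤ AddCommGrpCat.{w}}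
  (s : Correspondence E) (G : D ⥤ C) [G.Full] [G.Faithful] [G.EssSurj]
  (θ : ∀ Z A : D, Ext E' Z A ≃+ Ext E (G.obj Z) (G.obj A))

variable {G} in
/-- The preimage of a class of sequences under a fully faithful and essentially surjective
functor. -/
def SequenceClass.preimage {A Z : D} (S : SequenceClass (G.obj A) (G.obj Z)) :
    SequenceClass A Z :=
  cls (B := G.objPreimage S.out.B) (G.preimage (S.out.x ≫ (G.objObjPreimageIso S.out.B).inv))
    (G.preimage ((G.objObjPreimageIso S.out.B).hom ≫ S.out.y))

variable {G} in
lemma SequenceClass.preimage_eq_cls_iff {A B Z : D} (S : SequenceClass (G.obj A) (G.obj Z))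
    (x : A ⟶ B) (y : B ⟶ Z) : S.preimage = cls x y ↔ S = cls (G.map x) (G.map y) := by
  have hS : S = cls S.out.x S.out.y := (Quotient.out_eq S).symm
  constructor
  · intro h
    obtain ⟨b, h₁, h₂⟩ := cls_eq_cls_iff.1 h
    rw [hS]
    refine cls_eq_cls_of_iso ((G.objObjPreimageIso S.out.B).symm ≪≫ G.mapIso b) ?_ ?_
    · simpa using congrArg G.map h₁
    · simp [← G.map_comp, h₂]
  · intro h
    obtain ⟨b, h₁, h₂⟩ := cls_eq_cls_iff.1 (hS.symm.trans h)
    refine cls_eq_cls_of_iso (G.preimageIso (G.objObjPreimageIso S.out.B ≪≫ b)) ?_ ?_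
    · apply G.map_injective; simp [h₁]
    · apply G.map_injective; simp [h₂]

variable {G} in
/-- The correspondence on `D` induced by one on `C`. -/
def transport : Correspondence E' := fun A Z δ => (s (θ Z A δ)).preimage

variable {s θ} in
lemma transport_eq_cls_iff {A B Z : D} (δ : Ext E' Z A) (x : A ⟶ B) (y : B ⟶ Z) :
    transport s θ δ = cls x y ↔ s (θ Z A δ) = cls (G.map x) (G.map y) :=
  SequenceClass.preimage_eq_cls_iff _ _ _

/-- An additive functor commutes with biproducts. -/
@[simps]
def biprodComparisonIso [Preadditive C] [HasBinaryBiproducts C] [Preadditive D]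
    [HasBinaryBiproducts D] (G : D ⥤ C) [G.Additive] (A A' : D) :
    G.obj A ⊞ G.obj A' ≅ G.obj (A ⊞ A') where
  hom := biprod.desc (G.map biprod.inl) (G.map biprod.inr)
  inv := biprod.lift (G.map biprod.fst) (G.map biprod.snd)
  hom_inv_id := by ext <;> simp [← G.map_comp]
  inv_hom_id := by
    rw [biprod.lift_desc, ← G.map_comp, ← G.map_comp, ← G.map_add, biprod.total, G.map_id]

variable {G θ} [Preadditive C] [HasZeroObject C] [HasBinaryBiproducts C]
  [Preadditive D] [HasBinaryBiproducts D] [G.Additive]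

variable {s} in
/-- Extriangulated structures are transported along equivalences. -/
theorem IsExtriangulated.transport (hC : IsExtriangulated E s)
    (hpush : ∀ {Z A A' : D} (a : A ⟶ A') (δ : Ext E' Z A),
      θ _ _ (push a δ) = push (G.map a) (θ _ _ δ))
    (hpull : ∀ {Z Z' A : D} (c : Z' ⟶ Z) (δ : Ext E' Z A),
      θ _ _ (pull c δ) = pull (G.map c) (θ _ _ δ)) :
    IsExtriangulated E' (transport s θ) where
  additive_right Z := ⟨fun {A A' f g} => by
    refine AddCommGrpCat.hom_ext (AddMonoidHom.ext fun δ => (θ Z.unop A').injective ?_)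
    change θ _ _ (push (f + g) δ) = θ _ _ (push f δ + push g δ)
    rw [map_add, hpush, hpush, hpush, G.map_add, hC.add_push]⟩
  additive_left A := ⟨fun {Z Z' f g} => by
    refine AddCommGrpCat.hom_ext (AddMonoidHom.ext fun δ => (θ Z'.unop A).injective ?_)
    change θ _ _ (pull (f.unop + g.unop) δ) = θ _ _ (pull f.unop δ + pull g.unop δ)
    rw [map_add, hpull, hpull, hpull, G.map_add, hC.add_pull]⟩
  realisation := by
    intro A B Z A' B' Z' δ δ' x y x' y' h h' a c hac
    rw [transport_eq_cls_iff] at h h'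
    obtain ⟨b, h₁, h₂⟩ := hC.realisation _ _ _ _ _ _ h h' (G.map a) (G.map c)
      (by rw [← hpush, ← hpull, hac])
    exact ⟨G.preimage b, G.map_injective (by simp [h₁]), G.map_injective (by simp [h₂])⟩
  realise_zero A Z := by
    refine (transport_eq_cls_iff _ _ _ _).2 ?_
    rw [map_zero, hC.realise_zero]
    exact cls_eq_cls_of_iso (biprodComparisonIso G A Z) (by simp)
      (by ext <;> simp [← G.map_comp])
  realise_sum := by
    intro A Z A' Z' δ δ'
    obtain ⟨B, x, y, h⟩ := (Extriangulated.transport s θ δ).exists_rep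
    obtain ⟨B', x', y', h'⟩ := (Extriangulated.transport s θ δ').exists_rep
    rw [h, h', SequenceClass.directSum_cls, transport_eq_cls_iff]
    rw [transport_eq_cls_iff] at h h'
    have h'' := hC.realise_sum (θ _ _ δ) (θ _ _ δ')
    rw [h, h', SequenceClass.directSum_cls] at h''
    -- The biproduct formed in `D` and then mapped by `G` agrees with the one formed in `C` only up
    -- to the comparison isomorphisms.
    refine hC.realise_iso h'' (biprodComparisonIso G A A') (biprodComparisonIso G B B')
      (biprodComparisonIso G Z Z') ?_ ?_ ?_
    · ext <;> simp <;> simp only [← G.map_comp, biprod.inl_map, biprod.inr_map]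
    · ext <;> simp <;> simp only [← G.map_comp, biprod.inl_map, biprod.inr_map]
    · simp only [extSum, map_add, hpush, hpull, push_add, pull_add, push_pull, pull_pull, push_push]
      simp [show (biprod.desc (G.map biprod.inl) (G.map biprod.inr) : _ ⟶ G.obj (Z ⊞ Z')) ≫
          G.map biprod.fst = biprod.fst by ext <;> simp [← G.map_comp],
        show (biprod.desc (G.map biprod.inl) (G.map biprod.inr) : _ ⟶ G.obj (Z ⊞ Z')) ≫
          G.map biprod.snd = biprod.snd by ext <;> simp [← G.map_comp]]
  et3 := by
    intro A B Z A' B' Z' δ δ' x y x' y' h h' a b hab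
    rw [transport_eq_cls_iff] at h h'
    obtain ⟨c, h₁, h₂⟩ := hC.et3 _ _ _ _ _ _ h h' (G.map a) (G.map b)
      (by rw [← G.map_comp, ← G.map_comp, hab])
    exact ⟨G.preimage c, (θ _ _).injective (by simp [hpush, hpull, h₁]),
      G.map_injective (by simp [h₂])⟩
  et3op := by
    intro A B Z A' B' Z' δ δ' x y x' y' h h' b c hbc
    rw [transport_eq_cls_iff] at h h'
    obtain ⟨a, h₁, h₂⟩ := hC.et3op _ _ _ _ _ _ h h' (G.map b) (G.map c)
      (by rw [← G.map_comp, ← G.map_comp, hbc])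
    exact ⟨G.preimage a, (θ _ _).injective (by simp [hpush, hpull, h₁]),
      G.map_injective (by simp [h₂])⟩
  et4 := by
    intro A B D' Z F δ δ' f f' g g' h₁ h₂
    rw [transport_eq_cls_iff] at h₁ h₂
    obtain ⟨X, d, e, h, h', δ'', rfl, k₁, k₂, k₃, k₄, k₅, k₆⟩ := hC.et4 _ _ _ _ _ _ h₁ h₂
    -- The object supplied by (ET4) in `C` is replaced by an isomorphic one in the image of `G`, and
    -- `δ''` is pulled back along `i`.
    let i := G.objObjPreimageIso X
    refine ⟨G.objPreimage X, G.preimage (d ≫ i.inv), G.preimage (i.hom ≫ e), f ≫ g,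
      G.preimage (h' ≫ i.inv), (θ _ _).symm (pull i.hom δ''), rfl, ?_, ?_, ?_, ?_, ?_, ?_⟩
    · exact G.map_injective (by simp [reassoc_of% k₁])
    · exact G.map_injective (by simp [k₂])
    · rw [transport_eq_cls_iff]
      exact hC.realise_iso k₃ (Iso.refl _) (Iso.refl _) i.symm (by simp) (by simp)
        (by simp [pull_pull])
    · rw [transport_eq_cls_iff, hpush, k₄]
      exact cls_eq_cls_of_iso i.symm (by simp) (by simp)
    · exact (θ _ _).injective (by simp [hpull, pull_pull, k₅])
    · exact (θ _ _).injective (by simp [hpull, hpush, push_pull, k₆, pull_pull])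
  et4op := by
    intro A B D' Z F δ δ' f' f g' g h₁ h₂
    rw [transport_eq_cls_iff] at h₁ h₂
    obtain ⟨X, d, e, h', h, δ'', rfl, k₁, k₂, k₃, k₄, k₅, k₆⟩ := hC.et4op _ _ _ _ _ _ h₁ h₂
    -- Here the new object is the covariant argument of `δ''`, so `δ''` is pushed along the inverse
    -- of `i`.
    let i := G.objObjPreimageIso X
    refine ⟨G.objPreimage X, G.preimage (d ≫ i.inv), G.preimage (i.hom ≫ e),
      G.preimage (i.hom ≫ h'), f ≫ g, (θ _ _).symm (push i.inv δ''), rfl, ?_, ?_, ?_, ?_, ?_, ?_⟩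
    · exact G.map_injective (by simp [k₁])
    · exact G.map_injective (by simp [k₂])
    · rw [transport_eq_cls_iff]
      exact hC.realise_iso k₃ i.symm (Iso.refl _) (Iso.refl _) (by simp) (by simp) (by simp)
    · rw [transport_eq_cls_iff, hpull, k₄]
      exact cls_eq_cls_of_iso i.symm (by simp) (by simp)
    · exact (θ _ _).injective (by simp [hpush, push_push, k₅])
    · exact (θ _ _).injective (by simp [hpull, hpush, ← push_pull, ← k₆, push_push])

end Transport

/-! ### The equivalence given by splitting objects -/

section Splitting

variable {C : Type u} [Category.{v} C]

namespace WeakCompletion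

/-- An object splitting the idempotent of `P`. -/
def image (P : WeakCompletion C) : C := P.property.choose

/-- The retraction onto the splitting object. -/
def retr (P : WeakCompletion C) : P.obj.X ⟶ P.image := P.property.choose_spec.choose

/-- The inclusion of the splitting object. -/
def incl (P : WeakCompletion C) : P.image ⟶ P.obj.X := P.property.choose_spec.choose_spec.choose

variable (P Q : WeakCompletion C)

lemma retr_incl : P.retr ≫ P.incl = P.obj.p := P.property.choose_spec.choose_spec.choose_spec.1

lemma incl_retr : P.incl ≫ P.retr = 𝟙 P.image :=
  P.property.choose_spec.choose_spec.choose_spec.2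

@[simp] lemma p_retr : P.obj.p ≫ P.retr = P.retr := by
  rw [← retr_incl, Category.assoc, incl_retr, Category.comp_id]

@[simp] lemma incl_p : P.incl ≫ P.obj.p = P.incl := by
  rw [← retr_incl, ← Category.assoc, incl_retr, Category.id_comp]

end WeakCompletion

open WeakCompletion

variable (C) in
/-- The functor sending a pair `(A, p)` to the object through which `p` splits. -/
def imageFunctor : WeakCompletion C ⥤ C where
  obj P := P.image
  map {P Q} f := P.incl ≫ f.hom.f ≫ Q.retr
  map_id P := by
    change P.incl ≫ P.obj.p ≫ P.retr = _
    rw [p_retr, incl_retr]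
  map_comp {P Q R} f g := by
    have : f.hom.f ≫ Q.obj.p = f.hom.f := Karoubi.comp_p f.hom
    change P.incl ≫ (f.hom.f ≫ g.hom.f) ≫ R.retr = _
    simp only [Category.assoc]
    rw [reassoc_of% Q.retr_incl, reassoc_of% this]

instance : (imageFunctor C).Full where
  map_surjective {P Q} := fun (h : P.image ⟶ Q.image) => by
    refine ⟨ObjectProperty.homMk ⟨P.retr ≫ h ≫ Q.incl, ?_⟩, ?_⟩
    · simp only [Category.assoc, incl_p]
      rw [← Category.assoc, p_retr]
    · change P.incl ≫ (P.retr ≫ h ≫ Q.incl) ≫ Q.retr = h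
      simp only [Category.assoc, incl_retr]
      rw [reassoc_of% P.incl_retr, Category.comp_id]

instance : (imageFunctor C).Faithful where
  map_injective {P Q} f g h := by
    have key (f : P ⟶ Q) : f.hom.f = P.retr ≫ (P.incl ≫ f.hom.f ≫ Q.retr) ≫ Q.incl := by
      simp only [Category.assoc, retr_incl]
      rw [reassoc_of% P.retr_incl]
      exact f.hom.comm.symm
    refine ObjectProperty.hom_ext _ (Karoubi.hom_ext _ _ ?_)
    rw [key f, key g]
    exact congrArg (fun k => P.retr ≫ k ≫ Q.incl) h

instance : (imageFunctor C).EssSurj where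
  -- The chosen splitting of `1_X` need not be `X` itself, but its two maps are then mutually
  -- inverse.
  mem_essImage X := ⟨(embedding C).obj X, ⟨⟨((embedding C).obj X).incl,
    ((embedding C).obj X).retr, incl_retr _, retr_incl _⟩⟩⟩

instance [Preadditive C] : (imageFunctor C).Additive where
  map_add {P Q f g} := by
    change P.incl ≫ (f.hom.f + g.hom.f) ≫ Q.retr = _
    rw [Preadditive.add_comp, Preadditive.comp_add]
    rfl

variable {E : Cᵒᵖ ⥤ C ⥤ AddCommGrpCat.{w}}

lemma underlying_push {Z A A' : WeakCompletion C} (a : A ⟶ A') (δ : Ext (weakBifunctor E) Z A) :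
    underlying (push a δ) = pullPush E Z.obj.p a.hom.f (underlying δ) := rfl

lemma underlying_pull {Z Z' A : WeakCompletion C} (c : Z' ⟶ Z) (δ : Ext (weakBifunctor E) Z A) :
    underlying (pull c δ) = pullPush E c.hom.f A.obj.p (underlying δ) := rfl

lemma pullPush_underlying {Z A : WeakCompletion C} (δ : Ext (weakBifunctor E) Z A) :
    pullPush E Z.obj.p A.obj.p (underlying δ) = underlying δ := pullPush_idem E Z.obj A.obj δ

/-- The extensions in the weak idempotent completion are those between the splitting objects. -/
def extImageEquiv (Z A : WeakCompletion C) : Ext (weakBifunctor E) Z A ≃+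
    Ext E Z.image A.image where
  toFun δ := pullPush E Z.incl A.retr (underlying δ)
  invFun ε := (⟨pullPush E Z.retr A.incl ε, pullPush E Z.retr A.incl ε, by
    rw [pullPush_comp, p_retr, incl_p]⟩ : cutSubgroup E Z.obj A.obj)
  -- The round trip is `p^* q_*`, which fixes the subgroup pointwise.
  left_inv δ := Subtype.ext (by
    change pullPush E Z.retr A.incl (pullPush E Z.incl A.retr (underlying δ)) = underlying δ
    rw [pullPush_comp, retr_incl, retr_incl, pullPush_underlying])
  right_inv ε := by
    change pullPush E Z.incl A.retr (pullPush E Z.retr A.incl ε) = ε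
    rw [pullPush_comp, incl_retr, incl_retr, pullPush_apply, push_id, pull_id]
  map_add' δ ε := map_add (pullPush E Z.incl A.retr) (underlying δ) (underlying ε)

lemma extImageEquiv_apply {Z A : WeakCompletion C} (δ : Ext (weakBifunctor E) Z A) :
    extImageEquiv Z A δ = pullPush E Z.incl A.retr (underlying δ) := rfl

lemma extImageEquiv_push {Z A A' : WeakCompletion C} (a : A ⟶ A')
    (δ : Ext (weakBifunctor E) Z A) :
    extImageEquiv Z A' (push a δ) = push (A.incl ≫ a.hom.f ≫ A'.retr) (extImageEquiv Z A δ) := by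
  have h : A.obj.p ≫ a.hom.f = a.hom.f := Karoubi.p_comp a.hom
  rw [extImageEquiv_apply, extImageEquiv_apply, underlying_push, pullPush_comp, incl_p,
    pullPush_apply, pullPush_apply, push_pull, push_push,
    reassoc_of% A.retr_incl, reassoc_of% h]

lemma extImageEquiv_pull {Z Z' A : WeakCompletion C} (c : Z' ⟶ Z)
    (δ : Ext (weakBifunctor E) Z A) :
    extImageEquiv Z' A (pull c δ) = pull (Z'.incl ≫ c.hom.f ≫ Z.retr) (extImageEquiv Z A δ) := by
  have h : c.hom.f ≫ Z.obj.p = c.hom.f := Karoubi.comp_p c.hom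
  rw [extImageEquiv_apply, extImageEquiv_apply, underlying_pull, pullPush_comp, p_retr,
    pullPush_apply, pullPush_apply, pull_pull, Category.assoc, Category.assoc,
    retr_incl, h]

/-- With `push_retr_extImageEquiv`, this exhibits the extension of splitting objects as a retract of
`δ`. It holds because `δ = p^* q_* δ`, and fails for general elements of `𝔼(Z, X)`. -/
lemma push_incl_extImageEquiv {X Z : WeakCompletion C} (δ : Ext (weakBifunctor E) Z X) :
    push X.incl (extImageEquiv Z X δ) = pull Z.incl (underlying δ) := by
  conv_rhs => rw [← pullPush_underlying]
  rw [extImageEquiv_apply, pullPush_apply, pullPush_apply, push_pull, push_push, retr_incl,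
    pull_pull, incl_p]

lemma push_retr_extImageEquiv {X Z : WeakCompletion C} (δ : Ext (weakBifunctor E) Z X) :
    push X.retr (underlying δ) = pull Z.retr (extImageEquiv Z X δ) := by
  conv_lhs => rw [← pullPush_underlying]
  rw [extImageEquiv_apply, pullPush_apply, pullPush_apply, push_pull, push_push, p_retr,
    pull_pull, retr_incl]

end Splitting

/-! ### The cut-out realisation and the embedding -/

section Main

open WeakCompletion

variable {C : Type u} [Category.{v} C] [Preadditive C]
  {E : Cᵒᵖ ⥤ C ⥤ AddCommGrpCat.{w}} {s : Correspondence E}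

variable (E) in
/-- The natural transformation `𝔼 ⟶ 𝔽(jᵒᵖ -, j -)`, which is the identity on underlying
extensions. -/
def embeddingExt : E ⟶ restrictBifunctor (embedding C) (weakBifunctor E) where
  app Z :=
    { app := fun A => AddCommGrpCat.ofHom
        ((AddMonoidHom.id (Ext E Z.unop A)).codRestrict
          (cutSubgroup E ((embedding C).obj Z.unop).obj ((embedding C).obj A).obj) fun δ =>
            ⟨δ, by
              change pullPush E (𝟙 Z.unop) (𝟙 A) δ = δ
              rw [pullPush_apply, push_id, pull_id]⟩)
      naturality := fun A A' a => AddCommGrpCat.hom_ext (AddMonoidHom.ext fun δ => Subtype.ext (by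
        change push a δ = pullPush E (𝟙 Z.unop) a δ
        rw [pullPush_apply, pull_id])) }
  naturality Z Z' c := by
    ext A : 2
    refine AddCommGrpCat.hom_ext (AddMonoidHom.ext fun δ => Subtype.ext ?_)
    change pull c.unop δ = pullPush E c.unop (𝟙 A) δ
    rw [pullPush_apply, push_id]

/-- On objects `(A, 1)` the identity of the middle term is an admissible `g`, and the sequence it
cuts out is the original one. -/
lemma isExtriangulatedFunctor_embedding {r : Correspondence (weakBifunctor E)}
    (hr : IsCutOut s r) : IsExtriangulatedFunctor s r (embedding C) := by
  refine ⟨⟨rfl⟩, embeddingExt E, fun A B Z δ x y h => ?_⟩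
  have hid : IsSplitIdempotent (𝟙 B) := ⟨B, 𝟙 B, 𝟙 B, by simp, by simp⟩
  rw [(hr (component (embeddingExt E) δ) x y h).2 (𝟙 B) hid
    ((Category.comp_id x).trans (Category.id_comp x).symm)
    ((Category.id_comp y).trans (Category.comp_id y).symm)]
  refine cls_eq_cls_of_iso (Iso.refl ((embedding C).obj B)) ?_ ?_
  · refine (Category.comp_id _).trans (ObjectProperty.hom_ext _ (Karoubi.hom_ext _ _ ?_))
    exact Category.id_comp x
  · refine (Category.id_comp _).trans (ObjectProperty.hom_ext _ (Karoubi.hom_ext _ _ ?_))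
    exact (Category.comp_id y).symm

variable (s) in
/-- The realisation of the extensions in the weak idempotent completion. -/
def weakCorrespondence : Correspondence (weakBifunctor E) :=
  transport s (G := imageFunctor C) extImageEquiv

variable [HasZeroObject C] [HasBinaryBiproducts C] {X Z : WeakCompletion C}
  (δ : Ext (weakBifunctor E) Z X)

/-- The relations `g x = x q` and `y g = p y` say precisely what is needed for the splitting maps to
commute with the sequences, so that the cut-out sequence is a retract of `𝔰(δ)`. -/
lemma realise_extImageEquiv (hC : IsExtriangulated E s) {Y' : WeakCompletion C}
    {x : X.obj.X ⟶ Y'.obj.X} {y : Y'.obj.X ⟶ Z.obj.X} (h : s (underlying δ) = cls x y)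
    (hx : x ≫ Y'.obj.p = X.obj.p ≫ x) (hy : Y'.obj.p ≫ y = y ≫ Z.obj.p) :
    s (extImageEquiv Z X δ) =
      cls (X.incl ≫ (X.obj.p ≫ x) ≫ Y'.retr) (Y'.incl ≫ (y ≫ Z.obj.p) ≫ Z.retr) := by
  refine hC.realise_retract h X.incl Y'.incl Z.incl X.retr Y'.retr Z.retr X.incl_retr
    Y'.incl_retr Z.incl_retr ?_ ?_ ?_ ?_ (push_incl_extImageEquiv δ) (push_retr_extImageEquiv δ)
  · simp only [Category.assoc, retr_incl]
    rw [hx, reassoc_of% X.incl_p, reassoc_of% X.incl_p]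
  · simp only [Category.assoc, p_retr, retr_incl]
    rw [← hy, reassoc_of% Y'.incl_p]
  · simp only [Category.assoc]
    rw [reassoc_of% X.incl_p, reassoc_of% X.retr_incl, ← reassoc_of% hx, p_retr]
  · simp only [Category.assoc, p_retr]
    rw [reassoc_of% Y'.retr_incl, reassoc_of% hy, p_retr]

lemma isCutOut_weakCorrespondence (hC : IsExtriangulated E s) :
    IsCutOut s (weakCorrespondence s) := by
  intro X Z δ Y x y h
  constructor
  · obtain ⟨Y', x', y', h'⟩ := (s (extImageEquiv Z X δ)).exists_rep
    obtain ⟨c, r, hcr, h₁, h₂, h₃, h₄⟩ := hC.exists_retraction h h' X.incl Z.incl X.retr Z.retr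
      X.incl_retr Z.incl_retr (push_incl_extImageEquiv δ) (push_retr_extImageEquiv δ)
    -- The idempotent `g` splits through the middle term `Y'` of the realisation of the retracted
    -- extension.
    refine ⟨r ≫ c, ⟨Y', r, c, rfl, hcr⟩, ?_, ?_⟩
    · rw [reassoc_of% h₃, h₁, reassoc_of% X.retr_incl]
    · rw [Category.assoc, h₂, reassoc_of% h₄, retr_incl]
  · intro g hg hx hy
    exact (transport_eq_cls_iff _ _ _ _).2
      (realise_extImageEquiv δ hC h (Y' := WeakCompletion.mk g hg) hx hy)

end Main

end Extriangulated

end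

theorem mainTheorem2 {C : Type u} [Category.{v} C] [Preadditive C] [HasZeroObject C]
    [HasBinaryBiproducts C]
    (E : Cᵒᵖ ⥤ C ⥤ AddCommGrpCat.{w}) (s : Extriangulated.Correspondence E)
    (hC : Extriangulated.IsExtriangulated E s) :
    ∃ r : Extriangulated.Correspondence (Extriangulated.weakBifunctor E),
      Extriangulated.IsCutOut s r ∧
      Extriangulated.IsExtriangulated (Extriangulated.weakBifunctor E) r ∧
      Extriangulated.IsExtriangulatedFunctor s r (Extriangulated.embedding C) :=
  have hr := Extriangulated.isCutOut_weakCorrespondence hC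
  ⟨Extriangulated.weakCorrespondence s, hr,
    hC.transport Extriangulated.extImageEquiv_push Extriangulated.extImageEquiv_pull,
    Extriangulated.isExtriangulatedFunctor_embedding hr⟩
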